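/- Let $k$ be a field and let $\mathrm{Vect}_f(k)$ be the monoidal category of finite-dimensional $k$-vector spaces. *Sovereign categories and functors.* In a monoidal category with unit $I$, a left dual of $X$ is an object ${}^\vee X$ with morphisms ${}^\vee X\otimes X\to I$ and $I\to X\otimes {}^\vee X$ satisfying the two triangle identities; a right dual is an object $X^\vee$ with morphisms $X\otimes X^\vee\to I$ and $I\to X^\vee\otimes X$ satisfying the triangle identities. A sovereign structure $\varphi$ on a monoidal category $\mathcal C$ consists of a choice of a left dual ${}^\vee X$ and of a right dual $X^\vee$ for every object $X$, together with an isomorphism of monoidal functors $\varphi:\mathbf D_r\cong \mathbf D_l$ between the associated right and left duality functors, i.e. isomorphisms $\varphi_X:X^\vee\to{}^\vee X$, natural in $X$ and compatible with the canonical isomorphisms $(X\otimes Y)^\vee\cong Y^\vee\otimes X^\vee$, ${}^\vee(X\otimes Y)\cong{}^\vee Y\otimes{}^\vee X$ and $I^\vee\cong I\cong{}^\vee I$. A sovereign monoidal category is a monoidal category with a sovereign structure. If $F$ is a (strong) monoidal functor between sovereign monoidal categories $(\mathcal C,\varphi)$ and $(\mathcal D,\psi)$, let $l_X:{}^\vee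 F(X)\cong F({}^\vee X)$ and $r_X:F(X)^\vee\cong F(X^\vee)$ be the canonical isomorphisms given by uniqueness of duals; $F$ is called sovereign if $F(\varphi_X)\circ r_X=l_X\circ\psi_{F(X)}$ for every object $X$ of $\mathcal C$. *The Hopf algebra $\mathrm{End}^\vee(F)$.* Let $\mathcal C$ be a small monoidal category with chosen left duals and $F=(F,\widetilde F):\mathcal C\to\mathrm{Vect}_f(k)$ a monoidal functor. Then $\mathrm{End}^\vee(F)$ is the quotient of $\bigoplus_{X\in\mathrm{ob}\,\mathcal C}\mathrm{End}_k(F(X))$ by the subspace spanned by the elements $g\circ F(f)-F(f)\circ g$ with $f\in\mathrm{Hom}_{\mathcal C}(X,Y)$ and $g\in\mathrm{Hom}_k(F(Y),F(X))$; the class of $g\in\mathrm{End}(F(X))$ is denoted $[X,g]$. It is a Hopf algebra with coproduct $\Delta([X,\phi\otimes x])=\sum_i[X,\phi\otimes v_i]\otimes[X,v_i^*\otimes x]$ (for $\phi\in F(X)^*$, $x\in F(X)$, $(v_i)$ a basis of $F(X)$), counit $\varepsilon([X,g])=\mathrm{Tr}(g)$, product $[X,g][Y,h]=[X\otimes Y,\widetilde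 F_{X,Y}\circ(g\otimes h)\circ\widetilde F_{X,Y}^{-1}]$, unit $[I,1]$ and antipode $S([X,g])=[{}^\vee X,\,l_X\circ{}^tg\circ l_X^{-1}]$, where $l_X:F(X)^*\cong F({}^\vee X)$ is the canonical isomorphism. A sovereign character on a Hopf algebra $A$ with antipode $S$ is an algebra morphism $\Phi:A\to k$ such that $S$ is bijective and $S^{-1}=\Phi*S*\Phi^{-1}$, where $*$ is the convolution product and $\Phi^{-1}$ the convolution inverse of $\Phi$. **Theorem.** Let $(\mathcal C,\otimes,I,\varphi)$ be a small sovereign monoidal category and let $F:\mathcal C\to\mathrm{Vect}_f(k)$ be a monoidal functor. (i) There is a sovereign character on the Hopf algebra $\mathrm{End}^\vee(F)$; in particular its antipode is bijective. (ii) If $F$ is a sovereign functor with respect to some (arbitrary) sovereign structure $\psi$ on $\mathrm{Vect}_f(k)$, then the antipode of $\mathrm{End}^\vee(F)$ satisfies $S\circ S=\mathrm{id}$. -/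

import Mathlib

universe w v u v₁ v₂ u₁ u₂

open CategoryTheory

noncomputable section

namespace CategoryTheory

open MonoidalCategory

/-! ### Sovereign monoidal categories and functors -/

section Pairing
variable {C : Type u₁} [Category.{v₁} C] [MonoidalCategory C]
  {D : Type u₂} [Category.{v₂} D] [MonoidalCategory D]
open Functor.LaxMonoidal Functor.OplaxMonoidal

/-- A monoidal functor `F` sends a dual pair to a dual pair. -/
abbrev mapExactPairing (F : C ⥤ D) [F.Monoidal] {X Y : C} (p : ExactPairing X Y) :
    ExactPairing (F.obj X) (F.obj Y) where
  coevaluation' := ε F ≫ F.map (η_ X Y) ≫ δ F X Y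
  evaluation' := μ F Y X ≫ F.map (ε_ X Y) ≫ η F
  coevaluation_evaluation' := by
    have h := congrArg F.map (ExactPairing.coevaluation_evaluation X Y)
    simp only [Functor.map_comp, Functor.Monoidal.map_whiskerLeft,
      Functor.Monoidal.map_whiskerRight, Functor.Monoidal.map_associator_inv,
      Functor.Monoidal.map_rightUnitor, Functor.Monoidal.map_leftUnitor_inv,
      Category.assoc, Functor.Monoidal.μ_δ_assoc] at h
    have h2 := congrArg (fun t => F.obj Y ◁ ε F ≫ μ F _ _ ≫ t ≫ δ F _ _ ≫ η F ▷ F.obj Y) h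
    simp only [Category.assoc, Functor.Monoidal.μ_δ_assoc, Functor.Monoidal.whiskerLeft_ε_η_assoc,
      Functor.Monoidal.whiskerRight_ε_η, Category.comp_id] at h2
    simpa only [MonoidalCategory.whiskerLeft_comp, comp_whiskerRight, Category.assoc] using h2
  evaluation_coevaluation' := by
    have h := congrArg F.map (ExactPairing.evaluation_coevaluation X Y)
    simp only [Functor.map_comp, Functor.Monoidal.map_whiskerLeft,
      Functor.Monoidal.map_whiskerRight, Functor.Monoidal.map_associator,
      Functor.Monoidal.map_rightUnitor_inv, Functor.Monoidal.map_leftUnitor,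
      Category.assoc, Functor.Monoidal.μ_δ_assoc] at h
    have h2 := congrArg (fun t => ε F ▷ F.obj X ≫ μ F _ _ ≫ t ≫ δ F _ _ ≫ F.obj X ◁ η F) h
    simp only [Category.assoc, Functor.Monoidal.μ_δ_assoc, Functor.Monoidal.whiskerRight_ε_η_assoc,
      Functor.Monoidal.whiskerLeft_ε_η, Category.comp_id] at h2
    simpa only [MonoidalCategory.whiskerLeft_comp, comp_whiskerRight, Category.assoc] using h2

/-- A sovereign monoidal category: an autonomous (rigid) monoidal category, with chosen left and
right duals, and an isomorphism of monoidal functors `φ : D_r ≅ D_l` between the right and the left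
duality functors, i.e. isomorphisms `φ_X : X^∨ ≅ ^∨X` natural in `X` and compatible with the
canonical isomorphisms `(X ⊗ Y)^∨ ≅ Y^∨ ⊗ X^∨`, `^∨(X ⊗ Y) ≅ ^∨Y ⊗ ^∨X`, `I^∨ ≅ I ≅ ^∨I`.

Convention: a left dual `^∨X`, with evaluation `^∨X ⊗ X ⟶ I` and coevaluation `I ⟶ X ⊗ ^∨X`, is
what Mathlib calls a right dual and denotes `Xᘁ`; a right dual `X^∨` is what Mathlib denotes `ᘁX`. -/
class SovereignCategory (C : Type u₁) [Category.{v₁} C] [MonoidalCategory C]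
    extends RigidCategory C where
  /-- The isomorphism `φ_X : X^∨ ≅ ^∨X`. -/
  φ (X : C) : (ᘁX : C) ≅ Xᘁ
  naturality {X Y : C} (f : X ⟶ Y) : (ᘁf) ≫ (φ X).hom = (φ Y).hom ≫ fᘁ
  tensor (X Y : C) : (φ (X ⊗ Y)).hom ≫ (rightDualTensorIso X Y).hom =
    (leftDualTensorIso X Y).hom ≫ ((φ Y).hom ⊗ₘ (φ X).hom)
  unit : (φ (𝟙_ C)).hom ≫
      (rightDualIso (rightDual (𝟙_ C)).exact exactPairingUnit).hom =
    (leftDualIso (leftDual (𝟙_ C)).exact exactPairingUnit).hom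

variable (F : C ⥤ D) [F.Monoidal]

/-- The comparison isomorphism `l_X : ^∨F(X) ≅ F(^∨X)` for a monoidal functor `F`, given by
uniqueness of left duals (Mathlib's right duals). -/
def mapRightDualIso [RightRigidCategory C] [RightRigidCategory D] (X : C) :
    (F.obj X)ᘁ ≅ F.obj Xᘁ :=
  rightDualIso (RightRigidCategory.rightDual (F.obj X)).exact
    (mapExactPairing F (RightRigidCategory.rightDual X).exact)

/-- The comparison isomorphism `r_X : F(X)^∨ ≅ F(X^∨)` for a monoidal functor `F`, given by
uniqueness of right duals (Mathlib's left duals). -/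
def mapLeftDualIso [LeftRigidCategory C] [LeftRigidCategory D] (X : C) :
    (ᘁ(F.obj X) : D) ≅ F.obj (ᘁX) :=
  leftDualIso (LeftRigidCategory.leftDual (F.obj X)).exact
    (mapExactPairing F (LeftRigidCategory.leftDual X).exact)

/-- A monoidal functor between sovereign monoidal categories `(C, φ)` and `(D, ψ)` is sovereign if
`F(φ_X) ∘ r_X = l_X ∘ ψ_{F(X)}` for all `X`. -/
def IsSovereignFunctor [SovereignCategory C] [SovereignCategory D] : Prop :=
  ∀ X : C, (mapLeftDualIso F X).hom ≫ F.map (SovereignCategory.φ X).hom =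
    (SovereignCategory.φ (F.obj X)).hom ≫ (mapRightDualIso F X).hom

theorem rightDualIso_evaluation {X Y₁ Y₂ : C} (p₁ : ExactPairing X Y₁) (p₂ : ExactPairing X Y₂) :
    (rightDualIso p₁ p₂).hom ▷ X ≫ p₂.evaluation' = p₁.evaluation' :=
  (@rightAdjointMate_comp_evaluation C _ _ X X ⟨Y₂⟩ ⟨Y₁⟩ (𝟙 X)).trans
    ((congrArg (· ≫ p₁.evaluation') (MonoidalCategory.whiskerLeft_id Y₁ X)).trans
      (Category.id_comp _))

theorem rightDualIso_coevaluation {X Y₁ Y₂ : C} (p₁ : ExactPairing X Y₁)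
    (p₂ : ExactPairing X Y₂) :
    p₁.coevaluation' ≫ X ◁ (rightDualIso p₁ p₂).hom = p₂.coevaluation' :=
  (@coevaluation_comp_rightAdjointMate C _ _ X X ⟨Y₂⟩ ⟨Y₁⟩ (𝟙 X)).trans
    ((congrArg (p₂.coevaluation' ≫ ·) (MonoidalCategory.id_whiskerRight X Y₂)).trans
      (Category.comp_id _))

end Pairing

/-! ### The coend of endomorphisms of a functor to finite-dimensional vector spaces -/

section Coend
open TensorProduct

variable {k : Type u} [Field k] {C : Type w} [Category.{v} C] (F : C ⥤ FGModuleCat.{u} k)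

/-- The linear map underlying `F(f)`. -/
abbrev linMap {X Y : C} (f : X ⟶ Y) : F.obj X →ₗ[k] F.obj Y := (F.map f).hom.hom

open Classical in
/-- The subspace `N` of `⨁_X End(F(X))` generated by the elements `g ∘ F(f) - F(f) ∘ g`. -/
def coendRelations : Submodule k (DirectSum C fun X => Module.End k (F.obj X)) :=
  Submodule.span k {z | ∃ (X Y : C) (f : X ⟶ Y) (g : F.obj Y →ₗ[k] F.obj X),
    z = DirectSum.lof k C (fun X => Module.End k (F.obj X)) X (g ∘ₗ linMap F f) -
      DirectSum.lof k C (fun X => Module.End k (F.obj X)) Y (linMap F f ∘ₗ g)}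

/-- The vector space `End^∨(F) = ⨁_X End(F(X)) / N`. -/
def EndDual : Type (max w u) :=
  (DirectSum C fun X => Module.End k (F.obj X)) ⧸ coendRelations F

namespace EndDual

instance : AddCommGroup (EndDual F) :=
  inferInstanceAs (AddCommGroup ((DirectSum C fun X => Module.End k (F.obj X)) ⧸ coendRelations F))

instance : Module k (EndDual F) :=
  inferInstanceAs (Module k ((DirectSum C fun X => Module.End k (F.obj X)) ⧸ coendRelations F))

open Classical in
/-- The class `[X, g]` in `End^∨(F)` of `g ∈ End(F(X))`. -/
def cls (X : C) : Module.End k (F.obj X) →ₗ[k] EndDual F :=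
  (coendRelations F).mkQ ∘ₗ DirectSum.lof k C (fun X => Module.End k (F.obj X)) X

theorem cls_comm {X Y : C} (f : X ⟶ Y) (g : F.obj Y →ₗ[k] F.obj X) :
    cls F X (g ∘ₗ linMap F f) = cls F Y (linMap F f ∘ₗ g) := by
  classical
  exact (Submodule.Quotient.eq _).2 (Submodule.subset_span ⟨X, Y, f, g, rfl⟩)

variable {F}

open Classical in
/-- Linear maps out of `End^∨(F)`, from compatible families. -/
def lift {M : Type*} [AddCommGroup M] [Module k M]
    (T : ∀ X : C, Module.End k (F.obj X) →ₗ[k] M)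
    (hT : ∀ {X Y : C} (f : X ⟶ Y) (g : F.obj Y →ₗ[k] F.obj X),
      T X (g ∘ₗ linMap F f) = T Y (linMap F f ∘ₗ g)) : EndDual F →ₗ[k] M :=
  (coendRelations F).liftQ (DirectSum.toModule k C M T) <| by
    refine Submodule.span_le.2 ?_
    rintro _ ⟨X, Y, f, g, rfl⟩
    simp [hT f g]

@[simp]
theorem lift_cls {M : Type*} [AddCommGroup M] [Module k M]
    (T : ∀ X : C, Module.End k (F.obj X) →ₗ[k] M)
    (hT : ∀ {X Y : C} (f : X ⟶ Y) (g : F.obj Y →ₗ[k] F.obj X),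
      T X (g ∘ₗ linMap F f) = T Y (linMap F f ∘ₗ g)) (X : C) (g : Module.End k (F.obj X)) :
    lift T hT (cls F X g) = T X g := by
  classical
  have : lift T hT (cls F X g) = DirectSum.toModule k C M T
    (DirectSum.lof k C (fun X => Module.End k (F.obj X)) X g) := rfl
  rw [this, DirectSum.toModule_lof]

/-- The class `[X, φ ⊗ x]` of the rank one operator `y ↦ φ(y) x`. -/
def coeff (X : C) (φ : Module.Dual k (F.obj X)) (x : F.obj X) : EndDual F :=
  cls F X (LinearMap.smulRight φ x)

theorem linearMap_eq_sum {V W : Type*} [AddCommGroup V] [Module k V] [AddCommGroup W] [Module k W]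
    {ι : Type*} [Fintype ι] (b : Module.Basis ι k V) (g : V →ₗ[k] W) :
    g = ∑ i, LinearMap.smulRight (b.coord i) (g (b i)) := by
  classical
  refine b.ext fun j => ?_
  simp [LinearMap.sum_apply, Finsupp.single_apply, ite_smul]

theorem dual_eq_sum {V : Type*} [AddCommGroup V] [Module k V] {ι : Type*} [Fintype ι]
    (b : Module.Basis ι k V) (φ : Module.Dual k V) : ∑ i, φ (b i) • b.coord i = φ := by
  ext x
  conv_rhs => rw [← b.sum_repr x]
  simp

theorem coev_nat {V W M : Type*} [AddCommGroup V] [Module k V] [AddCommGroup W] [Module k W]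
    [AddCommGroup M] [Module k M] {ι κ : Type*} [Fintype ι] [Fintype κ]
    (b : Module.Basis ι k V) (c : Module.Basis κ k W) (f : V →ₗ[k] W)
    (B : W →ₗ[k] Module.Dual k V →ₗ[k] M) :
    ∑ i, B (f (b i)) (b.coord i) = ∑ j, B (c j) (c.coord j ∘ₗ f) := by
  have h1 : ∀ j, c.coord j ∘ₗ f = ∑ i, c.coord j (f (b i)) • b.coord i := fun j =>
    (dual_eq_sum b (c.coord j ∘ₗ f)).symm
  have h2 : ∀ i, f (b i) = ∑ j, c.coord j (f (b i)) • c j := fun i => by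
    simp
  simp_rw [h1, map_sum, map_smul]
  conv_lhs => enter [2, i]; rw [h2 i, map_sum, LinearMap.sum_apply]
  simp_rw [map_smul, LinearMap.smul_apply]
  exact Finset.sum_comm

theorem coeff_add_right (X : C) (φ : Module.Dual k (F.obj X)) (x y : F.obj X) :
    coeff X φ (x + y) = coeff X φ x + coeff X φ y := by
  rw [coeff, coeff, coeff, ← map_add]; congr 1; ext; simp

theorem coeff_smul_right (X : C) (φ : Module.Dual k (F.obj X)) (a : k) (x : F.obj X) :
    coeff X φ (a • x) = a • coeff X φ x := by
  rw [coeff, coeff, ← map_smul]; congr 1; ext y; exact smul_comm (φ y) a x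

theorem coeff_add_left (X : C) (φ ψ : Module.Dual k (F.obj X)) (x : F.obj X) :
    coeff X (φ + ψ) x = coeff X φ x + coeff X ψ x := by
  rw [coeff, coeff, coeff, ← map_add]; congr 1; ext; simp [add_smul]

theorem coeff_smul_left (X : C) (φ : Module.Dual k (F.obj X)) (a : k) (x : F.obj X) :
    coeff X (a • φ) x = a • coeff X φ x := by
  rw [coeff, coeff, ← map_smul]; congr 1; ext; simp [mul_smul]

/-- `coeff` as a bilinear map. -/
def coeffₗ (X : C) : Module.Dual k (F.obj X) →ₗ[k] F.obj X →ₗ[k] EndDual F :=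
  LinearMap.mk₂ k (coeff X) (coeff_add_left X) (fun a φ x => coeff_smul_left X φ a x)
    (coeff_add_right X) (fun a φ x => coeff_smul_right X φ a x)

theorem coeffₗ_apply (X : C) (φ : Module.Dual k (F.obj X)) (x : F.obj X) :
    coeffₗ X φ x = coeff X φ x := rfl

theorem coeff_comm {X Y : C} (f : X ⟶ Y) (φ : Module.Dual k (F.obj Y)) (x : F.obj X) :
    coeff X (φ ∘ₗ linMap F f) x = coeff Y φ (linMap F f x) := by
  have h1 : LinearMap.smulRight (φ ∘ₗ linMap F f) x =
    LinearMap.smulRight φ x ∘ₗ linMap F f := rfl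
  have h2 : LinearMap.smulRight φ (linMap F f x) =
      linMap F f ∘ₗ LinearMap.smulRight φ x := by
    ext y; exact ((linMap F f).map_smul (φ y) x).symm
  rw [coeff, coeff, h1, h2, cls_comm]

theorem cls_eq_sum (X : C) {ι : Type*} [Fintype ι] (b : Module.Basis ι k (F.obj X))
    (g : Module.End k (F.obj X)) : cls F X g = ∑ i, coeff X (b.coord i) (g (b i)) := by
  conv_lhs => rw [linearMap_eq_sum b g, map_sum]
  rfl

theorem hom_ext {M : Type*} [AddCommGroup M] [Module k M] {S T : EndDual F →ₗ[k] M}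
    (h : ∀ (X : C) (φ : Module.Dual k (F.obj X)) (x : F.obj X),
      S (coeff X φ x) = T (coeff X φ x)) : S = T := by
  classical
  refine Submodule.linearMap_qext _ (DirectSum.linearMap_ext k fun X => LinearMap.ext fun g => ?_)
  change S (cls F X g) = T (cls F X g)
  rw [cls_eq_sum X (Module.finBasis k (F.obj X)), map_sum, map_sum]
  exact Finset.sum_congr rfl fun i _ => h _ _ _

theorem induction {P : EndDual F → Prop} (a : EndDual F)
    (add : ∀ a b, P a → P b → P (a + b)) (zero : P 0)
    (coeff : ∀ (X : C) (φ : Module.Dual k (F.obj X)) (x : F.obj X), P (coeff X φ x)) : P a := by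
  classical
  obtain ⟨z, rfl⟩ := Submodule.Quotient.mk_surjective _ a
  induction z using DirectSum.induction_on with
  | zero => exact zero
  | of X g =>
    change P (cls F X g)
    rw [cls_eq_sum X (Module.finBasis k (F.obj X))]
    exact Finset.sum_induction _ P add zero fun i _ => coeff _ _ _
  | add x y hx hy => exact add _ _ hx hy

/-! ### The coalgebra structure -/

/-- The comultiplication on the summand `End(F(X))`: writing `(v_i)` for a basis of `F(X)` and
`g = ∑_i v_i^* ⊗ g(v_i)`, it is
`g ↦ ∑_{i,j} [X, v_i^* ⊗ v_j] ⊗ [X, v_j^* ⊗ g(v_i)]`, the linear extension of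
`φ ⊗ x ↦ ∑_j [X, φ ⊗ v_j] ⊗ [X, v_j^* ⊗ x]`. -/
def comulAux (X : C) : Module.End k (F.obj X) →ₗ[k] EndDual F ⊗[k] EndDual F :=
  let b := Module.finBasis k (F.obj X)
  ∑ i, ∑ j, TensorProduct.mk k (EndDual F) (EndDual F) (coeff X (b.coord i) (b j)) ∘ₗ
    coeffₗ X (b.coord j) ∘ₗ LinearMap.applyₗ (b i)

theorem comulAux_rankOne (X : C) {ι : Type*} [Fintype ι] (c : Module.Basis ι k (F.obj X))
    (φ : Module.Dual k (F.obj X)) (x : F.obj X) :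
    comulAux X (LinearMap.smulRight φ x) = ∑ i, coeff X φ (c i) ⊗ₜ[k] coeff X (c.coord i) x := by
  set b := Module.finBasis k (F.obj X) with hb
  have h1 : comulAux X (LinearMap.smulRight φ x) =
      ∑ j, coeff X φ (b j) ⊗ₜ[k] coeff X (b.coord j) x := by
    simp only [comulAux, ← hb, LinearMap.sum_apply, LinearMap.comp_apply, coeffₗ_apply,
      LinearMap.applyₗ_apply_apply, LinearMap.smulRight_apply, coeff_smul_right,
      TensorProduct.mk_apply]
    rw [Finset.sum_comm]
    refine Finset.sum_congr rfl fun j _ => ?_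
    simp_rw [TensorProduct.tmul_smul, TensorProduct.smul_tmul', ← TensorProduct.sum_tmul,
      ← coeff_smul_left]
    congr 1
    conv_rhs => rw [← dual_eq_sum b φ]
    simp only [← coeffₗ_apply, map_sum, LinearMap.sum_apply]
  rw [h1]
  exact coev_nat b c LinearMap.id
    ((TensorProduct.mk k _ _ ∘ₗ coeffₗ X φ).compl₂ ((coeffₗ X).flip x))

theorem comulAux_comm {X Y : C} (f : X ⟶ Y) (g : F.obj Y →ₗ[k] F.obj X) :
    comulAux X (g ∘ₗ linMap F f) = comulAux Y (linMap F f ∘ₗ g) := by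
  set b := Module.finBasis k (F.obj X)
  set c := Module.finBasis k (F.obj Y)
  have hg := linearMap_eq_sum c g
  have h1 : g ∘ₗ linMap F f =
      ∑ i, LinearMap.smulRight (c.coord i) (g (c i)) ∘ₗ linMap F f := by
    ext y; conv_lhs => rw [hg]
    simp [LinearMap.sum_apply]
  have h2 : linMap F f ∘ₗ g =
      ∑ i, linMap F f ∘ₗ LinearMap.smulRight (c.coord i) (g (c i)) := by
    ext y; conv_lhs => rw [hg]
    simp [LinearMap.sum_apply]
  rw [h1, h2, map_sum, map_sum]
  refine Finset.sum_congr rfl fun i _ => ?_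
  generalize c.coord i = φ
  generalize g (c i) = x
  have h1 : LinearMap.smulRight φ x ∘ₗ linMap F f = LinearMap.smulRight (φ ∘ₗ linMap F f) x := rfl
  have h2 : linMap F f ∘ₗ LinearMap.smulRight φ x = LinearMap.smulRight φ (linMap F f x) := by
    ext y; exact (linMap F f).map_smul (φ y) x
  rw [h1, h2, comulAux_rankOne X b, comulAux_rankOne Y c]
  simp_rw [coeff_comm, ← coeff_comm f _ x]
  exact coev_nat b c (linMap F f)
    ((TensorProduct.mk k _ _ ∘ₗ coeffₗ Y φ).compl₂ ((coeffₗ X).flip x))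

/-- The coalgebra structure of `End^∨(F)`, with
`Δ[X, φ ⊗ x] = ∑_i [X, φ ⊗ v_i] ⊗ [X, v_i^* ⊗ x]` and `ε[X, g] = Tr(g)`. -/
instance : CoalgebraStruct k (EndDual F) where
  comul := lift comulAux comulAux_comm
  counit := lift (fun X => LinearMap.trace k (F.obj X)) fun f g =>
    LinearMap.trace_comp_comm' (linMap F f) g

theorem comul_coeff (X : C) {ι : Type*} [Fintype ι] (c : Module.Basis ι k (F.obj X))
    (φ : Module.Dual k (F.obj X)) (x : F.obj X) :
    Coalgebra.comul (R := k) (coeff X φ x) =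
      ∑ i, coeff X φ (c i) ⊗ₜ[k] coeff X (c.coord i) x :=
  (lift_cls _ _ _ _).trans (comulAux_rankOne X c φ x)

theorem counit_cls (X : C) (g : Module.End k (F.obj X)) :
    Coalgebra.counit (R := k) (cls F X g) = LinearMap.trace k (F.obj X) g :=
  lift_cls (fun X => LinearMap.trace k (F.obj X))
    (fun f g => LinearMap.trace_comp_comm' (linMap F f) g) X g

theorem counit_coeff (X : C) (φ : Module.Dual k (F.obj X)) (x : F.obj X) :
    Coalgebra.counit (R := k) (coeff X φ x) = φ x := by
  rw [coeff, counit_cls]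
  exact LinearMap.trace_smulRight φ x

instance : Coalgebra k (EndDual F) where
  coassoc := hom_ext fun X φ x => by
    simp only [LinearMap.comp_apply, comul_coeff X (Module.finBasis k (F.obj X)), map_sum,
      LinearMap.rTensor_tmul, LinearMap.lTensor_tmul, TensorProduct.sum_tmul,
      TensorProduct.tmul_sum, LinearEquiv.coe_coe, TensorProduct.assoc_tmul]
    exact Finset.sum_comm
  rTensor_counit_comp_comul := hom_ext fun X φ x => by
    set b := Module.finBasis k (F.obj X)
    simp only [LinearMap.comp_apply, comul_coeff X b, map_sum,
      LinearMap.rTensor_tmul, counit_coeff, TensorProduct.mk_apply]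
    conv_rhs => rw [← dual_eq_sum b φ]
    simp only [← coeffₗ_apply, map_sum, LinearMap.sum_apply, TensorProduct.tmul_sum, map_smul,
      LinearMap.smul_apply, TensorProduct.tmul_smul, TensorProduct.smul_tmul', smul_eq_mul, mul_one]
  lTensor_counit_comp_comul := hom_ext fun X φ x => by
    set b := Module.finBasis k (F.obj X)
    simp only [LinearMap.comp_apply, comul_coeff X b, map_sum,
      LinearMap.lTensor_tmul, counit_coeff, LinearMap.flip_apply, TensorProduct.mk_apply]
    conv_rhs => rw [← b.sum_repr x]
    simp only [← coeffₗ_apply, map_sum, TensorProduct.sum_tmul, map_smul,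
      ← TensorProduct.smul_tmul', ← TensorProduct.tmul_smul, smul_eq_mul, mul_one]
    simp

/-! ### The bialgebra structure -/

section Monoidal
variable [MonoidalCategory C]

open Functor.LaxMonoidal Functor.OplaxMonoidal

variable (F) in
/-- The structure isomorphism `F(X) ⊗ F(Y) ≅ F(X ⊗ Y)` as a linear equivalence. -/
def muEquiv [F.Monoidal] (X Y : C) : F.obj X ⊗[k] F.obj Y ≃ₗ[k] F.obj (X ⊗ Y) :=
  FGModuleCat.isoToLinearEquiv (Functor.Monoidal.μIso F X Y)

variable (F) in
/-- The structure isomorphism `k ≅ F(I)` as a linear equivalence. -/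
def unitEquiv [F.Monoidal] : k ≃ₗ[k] F.obj (𝟙_ C) :=
  FGModuleCat.isoToLinearEquiv (Functor.Monoidal.εIso F)

variable [F.Monoidal]

/-- The image of `x ⊗ y` in `F(X ⊗ Y)`. -/
def tens {X Y : C} (x : F.obj X) (y : F.obj Y) : F.obj (X ⊗ Y) := muEquiv F X Y (x ⊗ₜ[k] y)

theorem tens_natural {X X' Y Y' : C} (f : X ⟶ X') (g : Y ⟶ Y') (x : F.obj X) (y : F.obj Y) :
    linMap F (f ⊗ₘ g) (tens x y) = tens (linMap F f x) (linMap F g y) :=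
  (LinearMap.congr_fun (congrArg (fun t => t.hom.hom) (μ_natural F f g)) (x ⊗ₜ[k] y)).symm

theorem tens_whiskerLeft (X : C) {Y Y' : C} (g : Y ⟶ Y') (x : F.obj X) (y : F.obj Y) :
    linMap F (X ◁ g) (tens x y) = tens x (linMap F g y) :=
  (LinearMap.congr_fun (congrArg (fun t => t.hom.hom) (μ_natural_right F X g)) (x ⊗ₜ[k] y)).symm

theorem tens_whiskerRight {X X' : C} (f : X ⟶ X') (Y : C) (x : F.obj X) (y : F.obj Y) :
    linMap F (f ▷ Y) (tens x y) = tens (linMap F f x) y :=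
  (LinearMap.congr_fun (congrArg (fun t => t.hom.hom) (μ_natural_left F f Y)) (x ⊗ₜ[k] y)).symm

theorem tens_assoc {X Y Z : C} (x : F.obj X) (y : F.obj Y) (z : F.obj Z) :
    linMap F (α_ X Y Z).hom (tens (tens x y) z) = tens x (tens y z) :=
  LinearMap.congr_fun (congrArg (fun t => t.hom.hom) (Functor.LaxMonoidal.associativity F X Y Z))
    ((x ⊗ₜ[k] y) ⊗ₜ[k] z)

theorem unit_tens {X : C} (x : F.obj X) :
    linMap F (λ_ X).hom (tens (unitEquiv F 1) x) = x := by
  have h := LinearMap.congr_fun (congrArg (fun t => t.hom.hom) (Functor.LaxMonoidal.left_unitality F X))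
    ((1 : k) ⊗ₜ[k] x)
  exact h.symm.trans (one_smul k x)

theorem tens_unit {X : C} (x : F.obj X) :
    linMap F (ρ_ X).hom (tens x (unitEquiv F 1)) = x := by
  have h := LinearMap.congr_fun (congrArg (fun t => t.hom.hom) (Functor.LaxMonoidal.right_unitality F X))
    (x ⊗ₜ[k] (1 : k))
  exact h.symm.trans (one_smul k x)

/-- The linear form `x ⊗ y ↦ φ(x) ψ(y)` transported to `F(X ⊗ Y)`. -/
def tensDual {X Y : C} (φ : Module.Dual k (F.obj X)) (ψ : Module.Dual k (F.obj Y)) :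
    Module.Dual k (F.obj (X ⊗ Y)) :=
  LinearMap.mul' k k ∘ₗ TensorProduct.map φ ψ ∘ₗ (muEquiv F X Y).symm.toLinearMap

@[simp]
theorem tensDual_tens {X Y : C} (φ : Module.Dual k (F.obj X)) (ψ : Module.Dual k (F.obj Y))
    (x : F.obj X) (y : F.obj Y) : tensDual φ ψ (tens x y) = φ x * ψ y := by
  simp [tensDual, tens]

theorem tens_ext {X Y : C} {M : Type*} [AddCommGroup M] [Module k M]
    {f g : F.obj (X ⊗ Y) →ₗ[k] M} (h : ∀ x y, f (tens x y) = g (tens x y)) : f = g := by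
  have : f ∘ₗ (muEquiv F X Y).toLinearMap = g ∘ₗ (muEquiv F X Y).toLinearMap :=
    TensorProduct.ext' h
  ext z
  obtain ⟨w, rfl⟩ := (muEquiv F X Y).surjective z
  exact LinearMap.congr_fun this w

theorem tens_ext₃ {X Y Z : C} {M : Type*} [AddCommGroup M] [Module k M]
    {f g : F.obj ((X ⊗ Y) ⊗ Z) →ₗ[k] M}
    (h : ∀ x y z, f (tens (tens x y) z) = g (tens (tens x y) z)) : f = g := by
  refine tens_ext fun w z => ?_
  have := tens_ext
    (f := f ∘ₗ (muEquiv F (X ⊗ Y) Z).toLinearMap ∘ₗ (TensorProduct.mk k _ _).flip z)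
    (g := g ∘ₗ (muEquiv F (X ⊗ Y) Z).toLinearMap ∘ₗ (TensorProduct.mk k _ _).flip z)
    fun x y => h x y z
  exact LinearMap.congr_fun this w

/-- The product of the summands `End(F(X))` and `End(F(Y))`:
`(g, h) ↦ [X ⊗ Y, F̃ ∘ (g ⊗ h) ∘ F̃⁻¹]`. -/
def mulAux (X Y : C) :
    Module.End k (F.obj X) →ₗ[k] Module.End k (F.obj Y) →ₗ[k] EndDual F :=
  (TensorProduct.mapBilinear (RingHom.id k) (F.obj X) (F.obj Y) (F.obj X) (F.obj Y)).compr₂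
    (cls F (X ⊗ Y) ∘ₗ (muEquiv F X Y).conj.toLinearMap)

theorem mulAux_apply (X Y : C) (g : Module.End k (F.obj X)) (h : Module.End k (F.obj Y)) :
    mulAux X Y g h = cls F (X ⊗ Y) ((muEquiv F X Y).toLinearMap ∘ₗ
      TensorProduct.map g h ∘ₗ (muEquiv F X Y).symm.toLinearMap) := rfl

theorem mulAux_comm_right (X : C) {Y Y' : C} (f : Y ⟶ Y') (g : Module.End k (F.obj X))
    (h : F.obj Y' →ₗ[k] F.obj Y) :
    mulAux X Y g (h ∘ₗ linMap F f) = mulAux X Y' g (linMap F f ∘ₗ h) := by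
  have key := cls_comm F (X ◁ f) ((muEquiv F X Y).toLinearMap ∘ₗ
      TensorProduct.map g h ∘ₗ (muEquiv F X Y').symm.toLinearMap)
  rw [mulAux_apply, mulAux_apply]
  convert key using 2
  · refine tens_ext fun x y => ?_
    simp only [LinearMap.comp_apply, tens_whiskerLeft]
    simp [tens]
  · refine tens_ext fun x y => ?_
    simp only [LinearMap.comp_apply, tens, LinearEquiv.coe_coe, LinearEquiv.symm_apply_apply,
      TensorProduct.map_tmul]
    exact (tens_whiskerLeft X f _ _).symm

theorem mulAux_comm_left {X X' : C} (f : X ⟶ X') (Y : C) (g : F.obj X' →ₗ[k] F.obj X)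
    (h : Module.End k (F.obj Y)) :
    mulAux X Y (g ∘ₗ linMap F f) h = mulAux X' Y (linMap F f ∘ₗ g) h := by
  have key := cls_comm F (f ▷ Y) ((muEquiv F X Y).toLinearMap ∘ₗ
      TensorProduct.map g h ∘ₗ (muEquiv F X' Y).symm.toLinearMap)
  rw [mulAux_apply, mulAux_apply]
  convert key using 2
  · refine tens_ext fun x y => ?_
    simp only [LinearMap.comp_apply, tens_whiskerRight]
    simp [tens]
  · refine tens_ext fun x y => ?_
    simp only [LinearMap.comp_apply, tens, LinearEquiv.coe_coe, LinearEquiv.symm_apply_apply,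
      TensorProduct.map_tmul]
    exact (tens_whiskerRight f Y _ _).symm

/-- Multiplication by elements of the summand `End(F(X))` on the left. -/
def mulSummand (X : C) : Module.End k (F.obj X) →ₗ[k] EndDual F →ₗ[k] EndDual F :=
  (lift (fun Y => (mulAux X Y).flip) fun f h =>
    LinearMap.ext fun g => mulAux_comm_right X f g h).flip

theorem mulSummand_cls (X Y : C) (g : Module.End k (F.obj X)) (h : Module.End k (F.obj Y)) :
    mulSummand X g (cls F Y h) = mulAux X Y g h :=
  LinearMap.congr_fun (lift_cls (fun Y => (mulAux X Y).flip)
    (fun f h => LinearMap.ext fun g => mulAux_comm_right X f g h) Y h) g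

theorem mulSummand_comm {X X' : C} (f : X ⟶ X') (g : F.obj X' →ₗ[k] F.obj X) :
    mulSummand X (g ∘ₗ linMap F f) = mulSummand X' (linMap F f ∘ₗ g) :=
  hom_ext fun Y ψ y => by
    rw [coeff, mulSummand_cls, mulSummand_cls, mulAux_comm_left]

variable (F) in
/-- The multiplication of `End^∨(F)`, as a bilinear map. -/
def mulₗ : EndDual F →ₗ[k] EndDual F →ₗ[k] EndDual F :=
  lift mulSummand mulSummand_comm

instance : Mul (EndDual F) := ⟨fun a b => mulₗ F a b⟩

instance : One (EndDual F) := ⟨cls F (𝟙_ C) LinearMap.id⟩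

theorem mul_def (a b : EndDual F) : a * b = mulₗ F a b := rfl

theorem cls_mul_cls (X Y : C) (g : Module.End k (F.obj X)) (h : Module.End k (F.obj Y)) :
    cls F X g * cls F Y h = cls F (X ⊗ Y) ((muEquiv F X Y).toLinearMap ∘ₗ
      TensorProduct.map g h ∘ₗ (muEquiv F X Y).symm.toLinearMap) := by
  rw [mul_def, mulₗ, lift_cls mulSummand mulSummand_comm, mulSummand_cls, mulAux_apply]

theorem coeff_mul_coeff {X Y : C} (φ : Module.Dual k (F.obj X)) (ψ : Module.Dual k (F.obj Y))
    (x : F.obj X) (y : F.obj Y) :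
    coeff X φ x * coeff Y ψ y = coeff (X ⊗ Y) (tensDual φ ψ) (tens x y) := by
  rw [coeff, coeff, cls_mul_cls, coeff]
  congr 1
  refine tens_ext fun v w => ?_
  rw [LinearMap.smulRight_apply, tensDual_tens]
  simp only [LinearMap.comp_apply, tens, LinearEquiv.coe_coe, LinearEquiv.symm_apply_apply,
    TensorProduct.map_tmul, LinearMap.smulRight_apply, TensorProduct.smul_tmul_smul, map_smul]

variable (F) in
/-- The linear form `F(I) → k` inverse to the structure isomorphism. -/
def unitDual : Module.Dual k (F.obj (𝟙_ C)) := (unitEquiv F).symm.toLinearMap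

theorem unitDual_unit : unitDual F (unitEquiv F 1) = 1 := by simp [unitDual]

theorem unitDual_smul (v : F.obj (𝟙_ C)) : unitDual F v • unitEquiv F 1 = v := by
  rw [← map_smul]; simp [unitDual]

theorem one_eq : (1 : EndDual F) = coeff (𝟙_ C) (unitDual F) (unitEquiv F 1) := by
  change cls F (𝟙_ C) LinearMap.id = cls F (𝟙_ C) _
  congr 1
  ext v
  exact (unitDual_smul v).symm

theorem tens_smul_left {X Y : C} (a : k) (x : F.obj X) (y : F.obj Y) :
    tens (a • x) y = a • tens x y := by
  simp [tens, ← TensorProduct.smul_tmul']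

theorem tens_smul_right {X Y : C} (a : k) (x : F.obj X) (y : F.obj Y) :
    tens x (a • y) = a • tens x y := by
  simp [tens]

protected theorem one_mul' (a : EndDual F) : 1 * a = a := by
  suffices h : mulₗ F 1 = LinearMap.id from LinearMap.congr_fun h a
  refine hom_ext fun X φ x => ?_
  rw [← mul_def, one_eq, coeff_mul_coeff]
  have h : tensDual (unitDual F) φ = φ ∘ₗ linMap F (λ_ X).hom := by
    refine tens_ext fun v y => ?_
    rw [tensDual_tens, LinearMap.comp_apply]
    conv_rhs => rw [← unitDual_smul v, tens_smul_left, map_smul, unit_tens, map_smul]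
    rfl
  rw [h, coeff_comm, unit_tens, LinearMap.id_apply]

protected theorem mul_one' (a : EndDual F) : a * 1 = a := by
  suffices h : (mulₗ F).flip 1 = LinearMap.id from LinearMap.congr_fun h a
  refine hom_ext fun X φ x => ?_
  rw [LinearMap.flip_apply, ← mul_def, one_eq, coeff_mul_coeff]
  have h : tensDual φ (unitDual F) = φ ∘ₗ linMap F (ρ_ X).hom := by
    refine tens_ext fun y v => ?_
    rw [tensDual_tens, LinearMap.comp_apply]
    conv_rhs => rw [← unitDual_smul v, tens_smul_right, map_smul, tens_unit, map_smul]
    exact mul_comm _ _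
  rw [h, coeff_comm, tens_unit, LinearMap.id_apply]

protected theorem mul_assoc' (a b c : EndDual F) : a * b * c = a * (b * c) := by
  induction a using EndDual.induction with
  | add a a' h h' => simp only [mul_def, map_add, LinearMap.add_apply] at h h' ⊢; rw [h, h']
  | zero => simp [mul_def]
  | coeff X φ x =>
  induction b using EndDual.induction with
  | add a a' h h' => simp only [mul_def, map_add, LinearMap.add_apply] at h h' ⊢; rw [h, h']
  | zero => simp [mul_def]
  | coeff Y ψ y =>
  induction c using EndDual.induction with
  | add a a' h h' => simp only [mul_def, map_add] at h h' ⊢; rw [h, h']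
  | zero => simp [mul_def]
  | coeff Z χ z =>
  simp only [coeff_mul_coeff]
  have h : tensDual (tensDual φ ψ) χ =
      tensDual φ (tensDual ψ χ) ∘ₗ linMap F (α_ X Y Z).hom := by
    refine tens_ext₃ fun x y z => ?_
    rw [LinearMap.comp_apply, tens_assoc]
    simp [mul_assoc]
  rw [h, coeff_comm, tens_assoc]

/-- The algebra structure of `End^∨(F)`, with unit `[I, 1]` and
`[X, g] [Y, h] = [X ⊗ Y, F̃ ∘ (g ⊗ h) ∘ F̃⁻¹]`. -/
instance : Ring (EndDual F) where
  __ := (inferInstance : AddCommGroup (EndDual F))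
  mul a b := a * b
  one := 1
  left_distrib a b c := map_add (mulₗ F a) b c
  right_distrib a b c := LinearMap.map_add₂ (mulₗ F) a b c
  zero_mul a := LinearMap.map_zero₂ (mulₗ F) a
  mul_zero a := map_zero (mulₗ F a)
  mul_assoc := EndDual.mul_assoc'
  one_mul := EndDual.one_mul'
  mul_one := EndDual.mul_one'

instance : Algebra k (EndDual F) :=
  Algebra.ofModule (fun r a b => LinearMap.map_smul₂ (mulₗ F) r a b)
    (fun r a b => map_smul (mulₗ F a) r b)

theorem comul_mul' (a b : EndDual F) : Coalgebra.comul (R := k) (a * b) =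
    Coalgebra.comul (R := k) a * Coalgebra.comul (R := k) b := by
  induction a using EndDual.induction with
  | add a a' h h' => simp only [add_mul, map_add, h, h']
  | zero => simp
  | coeff X φ x =>
  induction b using EndDual.induction with
  | add a a' h h' => simp only [mul_add, map_add, h, h']
  | zero => simp
  | coeff Y ψ y =>
  set b := Module.finBasis k (F.obj X)
  set c := Module.finBasis k (F.obj Y)
  set d := (b.tensorProduct c).map (muEquiv F X Y) with hd
  have h1 : ∀ i j, d (i, j) = tens (b i) (c j) := fun i j => by simp [hd, tens]
  have h2 : ∀ i j, d.coord (i, j) = tensDual (b.coord i) (c.coord j) := fun i j => by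
    refine tens_ext fun v w => ?_
    rw [tensDual_tens]
    simp [hd, tens, mul_comm]
  rw [coeff_mul_coeff, comul_coeff _ d, comul_coeff X b, comul_coeff Y c,
    Fintype.sum_prod_type, Finset.sum_mul_sum]
  refine Finset.sum_congr rfl fun i _ => Finset.sum_congr rfl fun j _ => ?_
  rw [Algebra.TensorProduct.tmul_mul_tmul, coeff_mul_coeff, coeff_mul_coeff, h1, h2]

theorem counit_mul' (a b : EndDual F) : Coalgebra.counit (R := k) (a * b) =
    Coalgebra.counit (R := k) a * Coalgebra.counit (R := k) b := by
  induction a using EndDual.induction with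
  | add a a' h h' => simp only [add_mul, map_add, h, h']
  | zero => simp
  | coeff X φ x =>
  induction b using EndDual.induction with
  | add a a' h h' => simp only [mul_add, map_add, h, h']
  | zero => simp
  | coeff Y ψ y =>
  rw [coeff_mul_coeff, counit_coeff, counit_coeff, counit_coeff, tensDual_tens]

theorem comul_one' : Coalgebra.comul (R := k) (1 : EndDual F) = 1 := by
  set d := (Module.Basis.singleton Unit k).map (unitEquiv F)
  have h : d.coord () = unitDual F := by ext v; simp [d, unitDual]
  rw [one_eq, comul_coeff _ d, Fintype.sum_unique, Algebra.TensorProduct.one_def, one_eq]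
  simp only [PUnit.default_eq_unit, h]
  simp [d]

/-- The bialgebra structure of `End^∨(F)` for a monoidal functor `F`. -/
instance : Bialgebra k (EndDual F) :=
  Bialgebra.mk' k (EndDual F) (by rw [one_eq, counit_coeff, unitDual_unit])
    (counit_mul' _ _) comul_one' (comul_mul' _ _)

/-! ### The Hopf algebra structure -/

section Antipode
variable [RightRigidCategory C]

variable (F) in
/-- The comparison isomorphism `l_X : F(X)^* ≅ F(^∨X)` as a linear equivalence. -/
def dualEquiv (X : C) : Module.Dual k (F.obj X) ≃ₗ[k] F.obj (Xᘁ) :=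
  FGModuleCat.isoToLinearEquiv (mapRightDualIso F X)

variable (F) in
/-- The pairing `F(^∨X) ⊗ F(X) → k` induced by the evaluation of `X`. -/
def pairing (X : C) : Module.Dual k (F.obj (Xᘁ ⊗ X)) :=
  unitDual F ∘ₗ linMap F (ε_ X Xᘁ)

theorem pairing_dualEquiv (X : C) (φ : Module.Dual k (F.obj X)) (x : F.obj X) :
    pairing F X (tens (dualEquiv F X φ) x) = φ x :=
  (LinearMap.congr_fun (congrArg (fun t => t.hom.hom) (rightDualIso_evaluation
    (RightRigidCategory.rightDual (F.obj X)).exact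
    (mapExactPairing F (RightRigidCategory.rightDual X).exact))) (φ ⊗ₜ[k] x)).trans
    (contractLeft_apply φ x)

theorem coev_dualEquiv (X : C) : ∑ i, tens (Module.Basis.ofVectorSpace k (F.obj X) i)
    (dualEquiv F X ((Module.Basis.ofVectorSpace k (F.obj X)).coord i)) =
      linMap F (η_ X Xᘁ) (unitEquiv F 1) := by
  have h := LinearMap.congr_fun (congrArg (fun t => t.hom.hom) (rightDualIso_coevaluation
    (RightRigidCategory.rightDual (F.obj X)).exact
    (mapExactPairing F (RightRigidCategory.rightDual X).exact))) (1 : k)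
  have h1 : (LinearMap.lTensor (F.obj X) (dualEquiv F X).toLinearMap)
      (coevaluation k (F.obj X) 1) =
      (muEquiv F X Xᘁ).symm (linMap F (η_ X Xᘁ) (unitEquiv F 1)) := h
  rw [LinearEquiv.eq_symm_apply, coevaluation_apply_one] at h1
  rw [← h1]
  simp only [map_sum, LinearMap.lTensor_tmul, tens, LinearEquiv.coe_coe]

theorem dualEquiv_naturality {X Y : C} (f : X ⟶ Y) (φ : Module.Dual k (F.obj Y)) :
    linMap F (fᘁ) (dualEquiv F Y φ) = dualEquiv F X (φ ∘ₗ linMap F f) := by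
  obtain ⟨ψ, hψ⟩ := (dualEquiv F X).surjective (linMap F (fᘁ) (dualEquiv F Y φ))
  rw [← hψ]
  congr 1
  ext x
  rw [← pairing_dualEquiv X ψ x, hψ, ← tens_whiskerRight, LinearMap.comp_apply,
    ← pairing_dualEquiv Y φ, ← tens_whiskerLeft]
  have h := LinearMap.congr_fun (congrArg (fun t => linMap F t)
    (rightAdjointMate_comp_evaluation f)) (tens (dualEquiv F Y φ) x)
  simp only [linMap, Functor.map_comp, FGModuleCat.hom_hom_comp] at h
  exact congrArg (unitDual F) h

/-- The antipode on the summand `End(F(X))`: `g ↦ [^∨X, l_X ∘ ^tg ∘ l_X⁻¹]`. -/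
def antipodeAux (X : C) : Module.End k (F.obj X) →ₗ[k] EndDual F :=
  cls F Xᘁ ∘ₗ (dualEquiv F X).conj.toLinearMap ∘ₗ Module.Dual.transpose

theorem antipodeAux_apply (X : C) (g : Module.End k (F.obj X)) :
    antipodeAux X g = cls F Xᘁ ((dualEquiv F X).toLinearMap ∘ₗ Module.Dual.transpose g ∘ₗ
      (dualEquiv F X).symm.toLinearMap) := rfl

theorem antipodeAux_comm {X Y : C} (f : X ⟶ Y) (g : F.obj Y →ₗ[k] F.obj X) :
    antipodeAux X (g ∘ₗ linMap F f) = antipodeAux Y (linMap F f ∘ₗ g) := by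
  have key := cls_comm F (fᘁ) ((dualEquiv F Y).toLinearMap ∘ₗ Module.Dual.transpose g ∘ₗ
      (dualEquiv F X).symm.toLinearMap)
  rw [antipodeAux_apply, antipodeAux_apply]
  refine Eq.trans ?_ (key.symm.trans ?_)
  · congr 1
    ext ξ
    simp only [LinearMap.comp_apply, LinearEquiv.coe_coe]
    rw [dualEquiv_naturality]
    rfl
  · congr 1
    ext ξ
    obtain ⟨φ, rfl⟩ := (dualEquiv F Y).surjective ξ
    simp only [LinearMap.comp_apply, LinearEquiv.coe_coe]
    rw [dualEquiv_naturality, LinearEquiv.symm_apply_apply, LinearEquiv.symm_apply_apply]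
    rfl

instance : HopfAlgebraStruct k (EndDual F) where
  antipode := lift antipodeAux antipodeAux_comm

theorem antipode_cls (X : C) (g : Module.End k (F.obj X)) :
    HopfAlgebra.antipode k (cls F X g) =
      cls F Xᘁ ((dualEquiv F X).toLinearMap ∘ₗ Module.Dual.transpose g ∘ₗ
        (dualEquiv F X).symm.toLinearMap) :=
  lift_cls antipodeAux antipodeAux_comm X g

theorem antipode_coeff (X : C) (φ : Module.Dual k (F.obj X)) (x : F.obj X) :
    HopfAlgebra.antipode k (coeff X φ x) =
      coeff Xᘁ (Module.Dual.eval k (F.obj X) x ∘ₗ (dualEquiv F X).symm.toLinearMap)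
        (dualEquiv F X φ) := by
  rw [coeff, antipode_cls, coeff]
  congr 1
  ext ξ
  obtain ⟨ψ, rfl⟩ := (dualEquiv F X).surjective ξ
  simp only [LinearMap.comp_apply, LinearEquiv.coe_coe, LinearEquiv.symm_apply_apply,
    LinearMap.smulRight_apply, ← map_smul]
  congr 1
  ext y
  simp [Module.Dual.transpose_apply, mul_comm]

/-- The Hopf algebra structure of `End^∨(F)` for a monoidal functor `F` on a left autonomous
category, with antipode `S[X, g] = [^∨X, l_X ∘ ^tg ∘ l_X⁻¹]`. -/
instance : HopfAlgebra k (EndDual F) where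
  mul_antipode_rTensor_comul := hom_ext fun X φ x => by
    set b := Module.Basis.ofVectorSpace k (F.obj X)
    simp only [LinearMap.comp_apply, comul_coeff X b, map_sum, LinearMap.rTensor_tmul,
      antipode_coeff, LinearMap.mul'_apply, coeff_mul_coeff, counit_coeff,
      Algebra.linearMap_apply]
    have h : ∑ i, tensDual (Module.Dual.eval k (F.obj X) (b i) ∘ₗ
        (dualEquiv F X).symm.toLinearMap) (b.coord i) = pairing F X := by
      refine tens_ext fun ξ y => ?_
      obtain ⟨ψ, rfl⟩ := (dualEquiv F X).surjective ξ
      rw [pairing_dualEquiv, LinearMap.sum_apply]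
      refine Eq.trans ?_ (LinearMap.congr_fun (dual_eq_sum b ψ) y)
      rw [LinearMap.sum_apply]
      exact Finset.sum_congr rfl fun i _ => by simp
    simp only [← coeffₗ_apply]
    rw [← LinearMap.sum_apply, ← map_sum, h, coeffₗ_apply, pairing, coeff_comm]
    have h2 := pairing_dualEquiv X φ x
    rw [pairing, LinearMap.comp_apply] at h2
    rw [← unitDual_smul (linMap F (ε_ X Xᘁ) _), h2, coeff_smul_right, ← one_eq,
      Algebra.algebraMap_eq_smul_one]
  mul_antipode_lTensor_comul := hom_ext fun X φ x => by
    set b := Module.Basis.ofVectorSpace k (F.obj X)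
    simp only [LinearMap.comp_apply, comul_coeff X b, map_sum, LinearMap.lTensor_tmul,
      antipode_coeff, LinearMap.mul'_apply, coeff_mul_coeff, counit_coeff,
      Algebra.linearMap_apply]
    set θ := tensDual φ (Module.Dual.eval k (F.obj X) x ∘ₗ (dualEquiv F X).symm.toLinearMap)
    simp only [← coeffₗ_apply]
    rw [← map_sum, coev_dualEquiv, coeffₗ_apply, ← coeff_comm]
    have h : θ ∘ₗ linMap F (η_ X Xᘁ) = φ x • unitDual F := by
      ext v
      rw [← unitDual_smul v, map_smul, map_smul, LinearMap.comp_apply, ← coev_dualEquiv, map_sum]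
      simp only [θ, tensDual_tens, LinearMap.smul_apply, unitDual_unit]
      congr 1
      conv_rhs => rw [← b.sum_repr x]
      simp [b, mul_comm]
    rw [h, coeff_smul_left, ← one_eq, Algebra.algebraMap_eq_smul_one]

end Antipode

end Monoidal

end EndDual

end Coend

/-- A character `Φ` on a Hopf algebra `A` is sovereign if the antipode `S` is bijective and
`S⁻¹ = Φ * S * Φ⁻¹` for the convolution product, where `Φ⁻¹` is the convolution inverse of `Φ` and
linear forms on `A` are composed with the unit `k → A` in order to be multiplied with `S`. -/
def IsSovereignCharacter {k A : Type*} [Field k] [Ring A] [HopfAlgebra k A]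
    (Φ : A →ₐ[k] k) : Prop :=
  ∃ (Sinv : A →ₗ[k] A) (Φinv : A →ₗ[k] k),
    Sinv ∘ₗ HopfAlgebra.antipode k = LinearMap.id ∧
    HopfAlgebra.antipode k ∘ₗ Sinv = LinearMap.id ∧
    WithConv.toConv Φ.toLinearMap * WithConv.toConv Φinv = 1 ∧
    WithConv.toConv Φinv * WithConv.toConv Φ.toLinearMap = 1 ∧
    WithConv.toConv Sinv =
      WithConv.toConv (Algebra.linearMap k A ∘ₗ Φ.toLinearMap) *
        WithConv.toConv (HopfAlgebra.antipode k) *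
        WithConv.toConv (Algebra.linearMap k A ∘ₗ Φinv)

end CategoryTheory

end

noncomputable section

namespace CategoryTheory

open MonoidalCategory TensorProduct

/-! A single automorphism of `F` controls everything. Both F(X^∨) and F(^∨X) are dual to F(X)
through evaluation; comparing the two pairings across F(φ_X) gives a linear automorphism w_X of
F(X), called `sovEquiv`. The three axioms on φ say in turn that w is natural
(`sovEquiv_naturality`), multiplicative (`sovEquiv_tens`) and trivial on the unit vector
(`sovEquiv_unit`). Hence [X, g] ↦ Tr(w_X g) is an algebra morphism Φ, with convolution inverse given
by w⁻¹.

Convolving with Tr(T_X ·) inserts T into a matrix coefficient, so Φ * S * Φ⁻¹ sends [X, φ ⊗ x] to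
S[X, φ∘w ⊗ w⁻¹x] (`antipodeConj_coeff`). Applying S twice moves a coefficient from X to ^∨^∨X. The
sovereign structure provides an isomorphism X ≅ ^∨^∨X in the category itself (`bidualIso`), along
which the relations of the coend carry the coefficient back to X. Its image under F differs from the
linear identification with the bidual exactly by w (`leftForm_bidualIso`), and conjugation by Φ
cancels that discrepancy. So Φ * S * Φ⁻¹ is a two-sided inverse of S.

For (ii), a sovereign functor turns w_X into the automorphism of the space F(X) built from ψ and the
identity functor. A natural automorphism of the identity functor that fixes the unit vector of k
fixes every vector, so w = 1. Then Φ * S * Φ⁻¹ = S, and S is its own inverse. -/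

theorem leftDualIso_evaluation {C : Type u₁} [Category.{v₁} C] [MonoidalCategory C] {X₁ X₂ Y : C}
    (p₁ : ExactPairing X₁ Y) (p₂ : ExactPairing X₂ Y) :
    Y ◁ (leftDualIso p₁ p₂).hom ≫ p₂.evaluation' = p₁.evaluation' :=
  (@leftAdjointMate_comp_evaluation C _ _ Y Y ⟨X₂⟩ ⟨X₁⟩ (𝟙 Y)).trans
    ((congrArg (· ≫ p₁.evaluation') (MonoidalCategory.id_whiskerRight Y X₁)).trans
      (Category.id_comp _))

namespace EndDual

variable {k : Type u} [Field k] {C : Type w} [Category.{v} C]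

section Functoriality

variable (F : C ⥤ FGModuleCat.{u} k)

theorem linMap_comp_apply {X Y Z : C} (f : X ⟶ Y) (g : Y ⟶ Z) (x : F.obj X) :
    linMap F (f ≫ g) x = linMap F g (linMap F f x) := by
  simp only [linMap, Functor.map_comp, FGModuleCat.hom_hom_comp]
  rfl

theorem linMap_hom_inv {X Y : C} (i : X ≅ Y) (x : F.obj X) :
    linMap F i.inv (linMap F i.hom x) = x := by
  rw [← linMap_comp_apply, i.hom_inv_id]
  simp [linMap]

end Functoriality

/-! ### Linear forms attached to natural endomorphisms of F, and their convolution -/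

section NatForm

variable {F : C ⥤ FGModuleCat.{u} k} (T : ∀ X : C, Module.End k (F.obj X))
  (hT : ∀ {X Y : C} (f : X ⟶ Y) (x : F.obj X), T Y (linMap F f x) = linMap F f (T X x))

include hT in
-- Cyclicity of the trace, after moving T past F(f). This makes the form Tr(T_X ·) vanish on the
-- relations of the coend.
theorem trace_natural {X Y : C} (f : X ⟶ Y) (g : F.obj Y →ₗ[k] F.obj X) :
    (LinearMap.trace k (F.obj X) ∘ₗ LinearMap.mulLeft k (T X)) (g ∘ₗ linMap F f) =
      (LinearMap.trace k (F.obj Y) ∘ₗ LinearMap.mulLeft k (T Y)) (linMap F f ∘ₗ g) := by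
  simp only [LinearMap.comp_apply, LinearMap.mulLeft_apply, Module.End.mul_eq_comp]
  rw [← LinearMap.comp_assoc, LinearMap.trace_comp_comm']
  congr 1
  ext y
  exact (hT f (g y)).symm

/-- The linear form `[X, g] ↦ Tr(T_X g)` for a natural endomorphism `T` of `F`. -/
def natForm : EndDual F →ₗ[k] k :=
  lift (fun X => LinearMap.trace k (F.obj X) ∘ₗ LinearMap.mulLeft k (T X)) (trace_natural T hT)

theorem natForm_coeff (X : C) (φ : Module.Dual k (F.obj X)) (x : F.obj X) :
    natForm T hT (coeff X φ x) = φ (T X x) := by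
  rw [coeff, natForm, lift_cls _ (trace_natural T hT)]
  have h : T X * LinearMap.smulRight φ x = LinearMap.smulRight φ (T X x) := by
    ext y
    simp [Module.End.mul_apply]
  rw [LinearMap.comp_apply, LinearMap.mulLeft_apply, h]
  exact LinearMap.trace_smulRight φ (T X x)

variable {A : Type*} [Ring A] [Algebra k A] (L : EndDual F →ₗ[k] A)

/-- In Δ[X, φ ⊗ x] the form meets the left factors [X, φ ⊗ v_i] and yields the scalars φ(T v_i).
These are the coordinates of φ∘T in the dual basis, so the sum collapses to one coefficient. -/
theorem natForm_convMul_coeff (X : C) (φ : Module.Dual k (F.obj X)) (x : F.obj X) :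
    (WithConv.toConv (Algebra.linearMap k A ∘ₗ natForm T hT) * WithConv.toConv L) (coeff X φ x) =
      L (coeff X (φ ∘ₗ T X) x) := by
  set b := Module.finBasis k (F.obj X)
  rw [LinearMap.convMul_apply, comul_coeff X b]
  simp only [map_sum, TensorProduct.map_tmul, LinearMap.mul'_apply, LinearMap.comp_apply,
    natForm_coeff, Algebra.linearMap_apply, ← Algebra.smul_def, ← map_smul, ← coeff_smul_left]
  rw [← map_sum]
  congr 1
  conv_rhs => rw [← dual_eq_sum b (φ ∘ₗ T X)]
  simp only [← coeffₗ_apply, map_sum, LinearMap.sum_apply, LinearMap.comp_apply]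

theorem convMul_natForm_coeff (X : C) (φ : Module.Dual k (F.obj X)) (x : F.obj X) :
    (WithConv.toConv L * WithConv.toConv (Algebra.linearMap k A ∘ₗ natForm T hT)) (coeff X φ x) =
      L (coeff X φ (T X x)) := by
  set b := Module.finBasis k (F.obj X)
  rw [LinearMap.convMul_apply, comul_coeff X b]
  simp only [map_sum, TensorProduct.map_tmul, LinearMap.mul'_apply, LinearMap.comp_apply,
    natForm_coeff, Algebra.linearMap_apply, ← Algebra.commutes, ← Algebra.smul_def, ← map_smul,
    ← coeff_smul_right]
  rw [← map_sum]
  congr 1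
  conv_rhs => rw [← b.sum_repr (T X x)]
  simp only [← coeffₗ_apply, map_sum]
  rfl

theorem natForm_convMul_convMul_natForm_coeff (T' : ∀ X : C, Module.End k (F.obj X))
    (hT' : ∀ {X Y : C} (f : X ⟶ Y) (x : F.obj X), T' Y (linMap F f x) = linMap F f (T' X x))
    (X : C) (φ : Module.Dual k (F.obj X)) (x : F.obj X) :
    (WithConv.toConv (Algebra.linearMap k A ∘ₗ natForm T hT) * WithConv.toConv L *
      WithConv.toConv (Algebra.linearMap k A ∘ₗ natForm T' hT')) (coeff X φ x) =
      L (coeff X (φ ∘ₗ T X) (T' X x)) := by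
  have h := convMul_natForm_coeff T' hT'
    (WithConv.toConv (Algebra.linearMap k A ∘ₗ natForm T hT) * WithConv.toConv L).ofConv X φ x
  rw [WithConv.toConv_ofConv] at h
  exact h.trans (natForm_convMul_coeff T hT L X φ _)

theorem natForm_convMul_natForm (T' : ∀ X : C, Module.End k (F.obj X))
    (hT' : ∀ {X Y : C} (f : X ⟶ Y) (x : F.obj X), T' Y (linMap F f x) = linMap F f (T' X x))
    (h : ∀ X x, T X (T' X x) = x) :
    WithConv.toConv (natForm T hT) * WithConv.toConv (natForm T' hT') = 1 := by
  refine WithConv.ofConv_injective (hom_ext fun X φ x => ?_)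
  -- For A = k the unit map k → A is the identity by unfolding, so the general formula applies.
  refine (natForm_convMul_coeff T hT (natForm T' hT') X φ x).trans ?_
  rw [natForm_coeff, LinearMap.comp_apply, h]
  exact (counit_coeff X φ x).symm

end NatForm

variable [MonoidalCategory C]

/-! ### Pairings on vector spaces induced by dual pairs -/

section Forms

variable (F : C ⥤ FGModuleCat.{u} k) [F.Monoidal]

theorem tens_assoc_inv {X Y Z : C} (x : F.obj X) (y : F.obj Y) (z : F.obj Z) :
    linMap F (α_ X Y Z).inv (tens x (tens y z)) = tens (tens x y) z := by
  rw [← tens_assoc, linMap_hom_inv]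

/-- The bilinear form `F(Y) × F(X) → k` induced by the evaluation of a dual pair. -/
def evalForm {X Y : C} (p : ExactPairing X Y) : F.obj Y →ₗ[k] F.obj X →ₗ[k] k :=
  (TensorProduct.mk k (F.obj Y) (F.obj X)).compr₂
    (unitDual F ∘ₗ linMap F p.evaluation' ∘ₗ (muEquiv F Y X).toLinearMap)

theorem evalForm_apply {X Y : C} (p : ExactPairing X Y) (y : F.obj Y) (x : F.obj X) :
    evalForm F p y x = unitDual F (linMap F p.evaluation' (tens y x)) := rfl

/-- The comparison isomorphism `F(X)^* ≅ F(Y)` for a dual pair `(X, Y)`. -/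
def pairEquiv {X Y : C} (p : ExactPairing X Y) : Module.Dual k (F.obj X) ≃ₗ[k] F.obj Y :=
  FGModuleCat.isoToLinearEquiv (rightDualIso (FGModuleCat.rightDual k (F.obj X)).exact
    (mapExactPairing F p))

@[simp]
theorem evalForm_pairEquiv {X Y : C} (p : ExactPairing X Y) (φ : Module.Dual k (F.obj X))
    (x : F.obj X) : evalForm F p (pairEquiv F p φ) x = φ x :=
  (LinearMap.congr_fun (congrArg (fun t => t.hom.hom) (rightDualIso_evaluation
    (FGModuleCat.rightDual k (F.obj X)).exact (mapExactPairing F p))) (φ ⊗ₜ[k] x)).trans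
    (contractLeft_apply φ x)

theorem pairEquiv_symm_apply {X Y : C} (p : ExactPairing X Y) (y : F.obj Y) :
    (pairEquiv F p).symm y = evalForm F p y := by
  obtain ⟨φ, rfl⟩ := (pairEquiv F p).surjective y
  ext x
  simp

variable {F}

/-- Pairing against F(X) is the inverse of the isomorphism `pairEquiv`, hence injective. -/
theorem evalForm_ext_left {X Y : C} (p : ExactPairing X Y) {y y' : F.obj Y}
    (h : ∀ x, evalForm F p y x = evalForm F p y' x) : y = y' := by
  apply (pairEquiv F p).symm.injective
  rw [pairEquiv_symm_apply, pairEquiv_symm_apply]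
  exact LinearMap.ext h

/-- Allows the chosen dual of I or of X ⊗ Y to be replaced by the explicit one, on which the pairing
can be computed. -/
theorem evalForm_rightDualIso {X Y₁ Y₂ : C} (p₁ : ExactPairing X Y₁) (p₂ : ExactPairing X Y₂)
    (y : F.obj Y₁) (x : F.obj X) :
    evalForm F p₂ (linMap F (rightDualIso p₁ p₂).hom y) x = evalForm F p₁ y x := by
  rw [evalForm_apply, evalForm_apply, ← rightDualIso_evaluation p₁ p₂, linMap_comp_apply,
    tens_whiskerRight]

theorem evalForm_leftDualIso {X₁ X₂ Y : C} (p₁ : ExactPairing X₁ Y) (p₂ : ExactPairing X₂ Y)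
    (y : F.obj Y) (x : F.obj X₁) :
    evalForm F p₂ y (linMap F (leftDualIso p₁ p₂).hom x) = evalForm F p₁ y x := by
  rw [evalForm_apply, evalForm_apply, ← leftDualIso_evaluation p₁ p₂, linMap_comp_apply,
    tens_whiskerLeft]

/-- The evaluation is nested: the inner pair Y₁, X₁ is contracted first. The result lies in the line
F(I), so it is a scalar times the unit vector, and this scalar comes out before the outer pair is
contracted. -/
theorem evalForm_tensor {X₁ X₂ Y₁ Y₂ : C} (p : ExactPairing X₁ Y₁) (q : ExactPairing X₂ Y₂)
    (y₁ : F.obj Y₁) (y₂ : F.obj Y₂) (x₁ : F.obj X₁) (x₂ : F.obj X₂) :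
    evalForm F ExactPairing.tensor (tens y₂ y₁) (tens x₁ x₂) =
      evalForm F p y₁ x₁ * evalForm F q y₂ x₂ := by
  have h : (ExactPairing.tensor (X₁ := X₁) (X₂ := X₂) (Y₁ := Y₁) (Y₂ := Y₂)).evaluation' =
      (α_ Y₂ Y₁ (X₁ ⊗ X₂)).hom ≫ Y₂ ◁ ((α_ Y₁ X₁ X₂).inv ≫ p.evaluation' ▷ X₂ ≫ (λ_ X₂).hom) ≫
        q.evaluation' := by
    change 𝟙 _ ⊗≫ Y₂ ◁ (p.evaluation' ▷ X₂) ⊗≫ q.evaluation' = _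
    monoidal
  rw [evalForm_apply, h, linMap_comp_apply, linMap_comp_apply, tens_assoc, tens_whiskerLeft,
    linMap_comp_apply, linMap_comp_apply, tens_assoc_inv, tens_whiskerRight,
    ← unitDual_smul (linMap F p.evaluation' _), tens_smul_left, map_smul, unit_tens,
    tens_smul_right, map_smul, map_smul, smul_eq_mul]
  rfl

end Forms

/-! ### The monoidal automorphism w of F defined by the sovereign structure -/

section Sovereign

variable [SovereignCategory C] (F : C ⥤ FGModuleCat.{u} k) [F.Monoidal]

/-- The pairing between `F(^∨X)` and `F(X)`. -/
abbrev leftForm (X : C) : F.obj (Xᘁ) →ₗ[k] F.obj X →ₗ[k] k :=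
  evalForm F (RightRigidCategory.rightDual X).exact

/-- The pairing between `F(X)` and `F(X^∨)`. -/
abbrev rightForm (X : C) : F.obj X →ₗ[k] F.obj (ᘁX : C) →ₗ[k] k :=
  evalForm F (LeftRigidCategory.leftDual X).exact

/-- The automorphism `w` of `F(X)` with `⟨w x, ζ⟩ = ⟨F(φ_X) ζ, x⟩` for `ζ ∈ F(X^∨)`. -/
def sovEquiv (X : C) : F.obj X ≃ₗ[k] F.obj X :=
  Module.evalEquiv k (F.obj X) ≪≫ₗ (dualEquiv F X).symm.dualMap ≪≫ₗ
    (FGModuleCat.isoToLinearEquiv (F.mapIso (SovereignCategory.φ X))).dualMap ≪≫ₗ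
    pairEquiv F (LeftRigidCategory.leftDual X).exact

variable {F}

theorem dualEquiv_eq (X : C) :
    dualEquiv F X = pairEquiv F (RightRigidCategory.rightDual X).exact := rfl

theorem rightForm_sovEquiv (X : C) (x : F.obj X) (ζ : F.obj (ᘁX : C)) :
    rightForm F X (sovEquiv F X x) ζ =
      leftForm F X (linMap F (SovereignCategory.φ X).hom ζ) x := by
  rw [sovEquiv]
  simp only [LinearEquiv.trans_apply]
  rw [rightForm, evalForm_pairEquiv, leftForm, ← pairEquiv_symm_apply, ← dualEquiv_eq]
  rfl

/-- The right pairing is nondegenerate, so its values determine w. Later identities for w are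
obtained by testing against an arbitrary ζ. -/
theorem sovEquiv_eq_iff (X : C) {x y : F.obj X} : sovEquiv F X x = y ↔ ∀ ζ : F.obj (ᘁX : C),
    rightForm F X y ζ = leftForm F X (linMap F (SovereignCategory.φ X).hom ζ) x := by
  refine ⟨?_, fun h => ?_⟩
  · rintro rfl ζ
    exact rightForm_sovEquiv X x ζ
  · exact evalForm_ext_left _ fun ζ => (rightForm_sovEquiv X x ζ).trans (h ζ).symm

theorem leftForm_mate {X Y : C} (f : X ⟶ Y) (ξ : F.obj (Yᘁ)) (x : F.obj X) :
    leftForm F X (linMap F (fᘁ) ξ) x = leftForm F Y ξ (linMap F f x) := by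
  rw [leftForm, leftForm, evalForm_apply, evalForm_apply, ← tens_whiskerRight,
    ← tens_whiskerLeft, ← linMap_comp_apply, ← linMap_comp_apply]
  exact congrArg (fun t => unitDual F (linMap F t (tens ξ x))) (rightAdjointMate_comp_evaluation f)

theorem rightForm_mate {X Y : C} (f : X ⟶ Y) (x : F.obj X) (ζ : F.obj (ᘁY : C)) :
    rightForm F X x (linMap F (ᘁf) ζ) = rightForm F Y (linMap F f x) ζ := by
  rw [rightForm, rightForm, evalForm_apply, evalForm_apply, ← tens_whiskerRight,
    ← tens_whiskerLeft, ← linMap_comp_apply, ← linMap_comp_apply]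
  exact congrArg (fun t => unitDual F (linMap F t (tens x ζ))) (leftAdjointMate_comp_evaluation f)

/-- Mates become transposes for the two pairings, so the claim tested against ζ is the naturality of
φ. -/
theorem sovEquiv_naturality {X Y : C} (f : X ⟶ Y) (x : F.obj X) :
    sovEquiv F Y (linMap F f x) = linMap F f (sovEquiv F X x) := by
  rw [sovEquiv_eq_iff]
  intro ζ
  rw [← rightForm_mate, rightForm_sovEquiv, ← leftForm_mate, ← linMap_comp_apply,
    ← linMap_comp_apply, SovereignCategory.naturality]

/-- Both duals of I can be replaced by I itself, and the unit axiom says that φ_I then becomes the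
identity. -/
theorem sovEquiv_unit : sovEquiv F (𝟙_ C) (unitEquiv F 1) = unitEquiv F 1 := by
  rw [sovEquiv_eq_iff]
  intro ζ
  rw [leftForm, ← evalForm_rightDualIso _ exactPairingUnit, ← linMap_comp_apply,
    SovereignCategory.unit, rightForm, ← evalForm_leftDualIso _ exactPairingUnit]
  generalize linMap F _ ζ = v
  -- F(I) is a line, so v is a multiple of the unit vector and the two arguments of the form may be
  -- exchanged.
  rw [← unitDual_smul v, map_smul, map_smul, LinearMap.smul_apply]

/-- The tensor axiom replaces φ of X ⊗ Y by φ_Y ⊗ φ_X once both duals are exchanged for tensor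
products of duals. There the pairings factor, and each factor is the defining identity of w. -/
theorem sovEquiv_tens (X Y : C) (x : F.obj X) (y : F.obj Y) :
    sovEquiv F (X ⊗ Y) (tens x y) = tens (sovEquiv F X x) (sovEquiv F Y y) := by
  rw [sovEquiv_eq_iff]
  intro ζ
  have hr := evalForm_leftDualIso (F := F) (LeftRigidCategory.leftDual (X ⊗ Y)).exact
    (ExactPairing.tensor (X₁ := (ᘁY : C)) (X₂ := (ᘁX : C)) (Y₁ := Y) (Y₂ := X))
    (tens (sovEquiv F X x) (sovEquiv F Y y)) ζ
  have hl := evalForm_rightDualIso (F := F) (RightRigidCategory.rightDual (X ⊗ Y)).exact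
    (ExactPairing.tensor (X₁ := X) (X₂ := Y) (Y₁ := Xᘁ) (Y₂ := Yᘁ))
    (linMap F (SovereignCategory.φ (X ⊗ Y)).hom ζ) (tens x y)
  have ht := SovereignCategory.tensor X Y
  rw [rightDualTensorIso, leftDualTensorIso] at ht
  rw [← linMap_comp_apply, ht, linMap_comp_apply] at hl
  rw [rightForm, leftForm, ← hr, ← hl]
  -- Only the image of ζ in F(Y^∨ ⊗ X^∨) still occurs. Both sides are linear in it, so pure tensors
  -- suffice.
  generalize linMap F _ ζ = θ
  refine LinearMap.congr_fun (f := evalForm F _ (tens (sovEquiv F X x) (sovEquiv F Y y)))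
    (g := (evalForm F _).flip (tens x y) ∘ₗ linMap F _) (tens_ext fun β α => ?_) θ
  rw [LinearMap.comp_apply, LinearMap.flip_apply, tens_natural, evalForm_tensor, evalForm_tensor]
  exact (congrArg₂ (· * ·) (rightForm_sovEquiv Y y β) (rightForm_sovEquiv X x α)).trans
    (mul_comm _ _)

/-- The evaluation ^∨X ⊗ X → I is a morphism, so the monoidal automorphism w commutes with it, and w
is trivial on F(I). Thus w on F(^∨X) is contragredient to w on F(X). -/
theorem leftForm_sovEquiv_sovEquiv (X : C) (ξ : F.obj (Xᘁ)) (x : F.obj X) :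
    leftForm F X (sovEquiv F Xᘁ ξ) (sovEquiv F X x) = leftForm F X ξ x := by
  rw [leftForm, evalForm_apply, evalForm_apply, ← sovEquiv_tens, ← sovEquiv_naturality]
  generalize linMap F _ (tens ξ x) = v
  rw [← unitDual_smul v, map_smul, sovEquiv_unit]

theorem leftForm_sovEquiv_symm (X : C) (ξ : F.obj (Xᘁ)) (x : F.obj X) :
    leftForm F X ξ ((sovEquiv F X).symm x) = leftForm F X (sovEquiv F Xᘁ ξ) x := by
  rw [← leftForm_sovEquiv_sovEquiv, LinearEquiv.apply_symm_apply]

/-! ### Biduals and the antipode on matrix coefficients -/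

/-- The isomorphism `X ≅ ^∨(^∨X)` of a sovereign category. -/
def bidualIso (X : C) : X ≅ (Xᘁ)ᘁ :=
  leftDualIso (RightRigidCategory.rightDual X).exact (LeftRigidCategory.leftDual Xᘁ).exact ≪≫
    SovereignCategory.φ Xᘁ

/-- The canonical isomorphism X ≅ (^∨X)^∨ preserves the pairing with F(^∨X), and φ at ^∨X
contributes w by the definition of w. So w measures how far F(`bidualIso`) is from the linear
identification with the bidual. -/
theorem leftForm_bidualIso (X : C) (x : F.obj X) (ξ : F.obj (Xᘁ)) :
    leftForm F Xᘁ (linMap F (bidualIso X).hom x) ξ = leftForm F X (sovEquiv F Xᘁ ξ) x := by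
  rw [bidualIso, Iso.trans_hom, linMap_comp_apply, ← rightForm_sovEquiv, rightForm,
    evalForm_leftDualIso]

theorem antipode_coeff_eq (X : C) (φ : Module.Dual k (F.obj X)) (x : F.obj X) :
    HopfAlgebra.antipode k (coeff X φ x) =
      coeff Xᘁ ((leftForm F X).flip x) (dualEquiv F X φ) := by
  rw [antipode_coeff]
  congr 1
  ext ξ
  rw [LinearMap.flip_apply, leftForm, ← pairEquiv_symm_apply]
  rfl

theorem dualEquiv_eq_of_forall (X : C) {φ : Module.Dual k (F.obj X)} {ξ : F.obj (Xᘁ)}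
    (h : ∀ x, leftForm F X ξ x = φ x) : dualEquiv F X φ = ξ :=
  evalForm_ext_left _ fun x => (evalForm_pairEquiv F _ φ x).trans (h x).symm

theorem leftForm_dualEquiv (X : C) (φ : Module.Dual k (F.obj X)) (x : F.obj X) :
    leftForm F X (dualEquiv F X φ) x = φ x :=
  evalForm_pairEquiv F _ φ x

theorem sovEquiv_symm_naturality {X Y : C} (f : X ⟶ Y) (x : F.obj X) :
    (sovEquiv F Y).symm (linMap F f x) = linMap F f ((sovEquiv F X).symm x) := by
  rw [LinearEquiv.symm_apply_eq, sovEquiv_naturality, LinearEquiv.apply_symm_apply]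

/-! ### The sovereign character and the inverse of the antipode -/

variable (F) in
/-- The character `[X, g] ↦ Tr(w_X g)`. -/
def sovCharacter : EndDual F →ₐ[k] k :=
  AlgHom.ofLinearMap (natForm (fun X => (sovEquiv F X).toLinearMap) sovEquiv_naturality)
    (by
      rw [one_eq, natForm_coeff, LinearEquiv.coe_coe, sovEquiv_unit, unitDual_unit])
    (fun a b => by
      induction a using EndDual.induction with
      | add a a' h h' => simp only [add_mul, map_add, h, h']
      | zero => simp
      | coeff X φ x =>
      induction b using EndDual.induction with
      | add a a' h h' => simp only [mul_add, map_add, h, h']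
      | zero => simp
      | coeff Y ψ y =>
      rw [coeff_mul_coeff, natForm_coeff, natForm_coeff, natForm_coeff, LinearEquiv.coe_coe,
        sovEquiv_tens, tensDual_tens]
      rfl)

variable (F) in
/-- The convolution inverse `[X, g] ↦ Tr(w_X⁻¹ g)` of the sovereign character. -/
def sovCharacterInv : EndDual F →ₗ[k] k :=
  natForm (fun X => (sovEquiv F X).symm.toLinearMap) sovEquiv_symm_naturality

variable (F) in
/-- The conjugate `Φ * S * Φ⁻¹` of the antipode by the sovereign character. -/
def antipodeConj : EndDual F →ₗ[k] EndDual F :=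
  (WithConv.toConv (Algebra.linearMap k (EndDual F) ∘ₗ
      natForm (fun X => (sovEquiv F X).toLinearMap) sovEquiv_naturality) *
    WithConv.toConv (HopfAlgebra.antipode k) *
    WithConv.toConv (Algebra.linearMap k (EndDual F) ∘ₗ sovCharacterInv F)).ofConv

theorem antipodeConj_coeff (X : C) (φ : Module.Dual k (F.obj X)) (x : F.obj X) :
    antipodeConj F (coeff X φ x) = HopfAlgebra.antipode k
      (coeff X (φ ∘ₗ (sovEquiv F X).toLinearMap) ((sovEquiv F X).symm x)) := by
  have h := natForm_convMul_convMul_natForm_coeff (fun X => (sovEquiv F X).toLinearMap)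
    sovEquiv_naturality (HopfAlgebra.antipode k (A := EndDual F))
    (fun X => (sovEquiv F X).symm.toLinearMap) sovEquiv_symm_naturality X φ x
  rw [antipodeConj]
  exact h

/-- The w inserted by Φ turns the functional ⟨·, x⟩ on F(^∨X) into the one represented by the image
of x under F(`bidualIso`). The coefficient on ^∨^∨X then returns to X by `coeff_comm`. -/
theorem antipodeConj_comp_antipode :
    antipodeConj F ∘ₗ HopfAlgebra.antipode k = LinearMap.id := by
  refine hom_ext fun X φ x => ?_
  have h1 : dualEquiv F Xᘁ ((leftForm F X).flip x ∘ₗ (sovEquiv F Xᘁ).toLinearMap) =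
      linMap F (bidualIso X).hom x :=
    dualEquiv_eq_of_forall Xᘁ fun ξ => leftForm_bidualIso X x ξ
  -- The w⁻¹ coming from Φ⁻¹ cancels the w produced by F(`bidualIso`).
  have h2 : (leftForm F Xᘁ).flip ((sovEquiv F Xᘁ).symm (dualEquiv F X φ)) ∘ₗ
      linMap F (bidualIso X).hom = φ := by
    ext y
    rw [LinearMap.comp_apply, LinearMap.flip_apply, leftForm_bidualIso,
      LinearEquiv.apply_symm_apply, leftForm_dualEquiv]
  rw [LinearMap.comp_apply, antipode_coeff_eq, antipodeConj_coeff, antipode_coeff_eq, h1,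
    ← coeff_comm, h2, LinearMap.id_apply]

/-- Here the conjugating w acts on F(X) rather than on F(^∨X). Contragredience, hence the
monoidality of w, moves it across the pairing. -/
theorem antipode_comp_antipodeConj :
    HopfAlgebra.antipode k ∘ₗ antipodeConj F = LinearMap.id := by
  refine hom_ext fun X φ x => ?_
  have h1 : dualEquiv F Xᘁ ((leftForm F X).flip ((sovEquiv F X).symm x)) =
      linMap F (bidualIso X).hom x :=
    dualEquiv_eq_of_forall Xᘁ fun ξ =>
      (leftForm_bidualIso X x ξ).trans (leftForm_sovEquiv_symm X ξ x).symm
  have h2 : (leftForm F Xᘁ).flip (dualEquiv F X (φ ∘ₗ (sovEquiv F X).toLinearMap)) ∘ₗ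
      linMap F (bidualIso X).hom = φ := by
    ext y
    rw [LinearMap.comp_apply, LinearMap.flip_apply, leftForm_bidualIso,
      ← leftForm_sovEquiv_symm, leftForm_dualEquiv, LinearMap.comp_apply, LinearEquiv.coe_coe,
      LinearEquiv.apply_symm_apply]
  rw [LinearMap.comp_apply, antipodeConj_coeff, antipode_coeff_eq, antipode_coeff_eq, h1,
    ← coeff_comm, h2, LinearMap.id_apply]

variable (F) in
theorem isSovereignCharacter_sovCharacter : IsSovereignCharacter (sovCharacter F) :=
  ⟨antipodeConj F, sovCharacterInv F, antipodeConj_comp_antipode, antipode_comp_antipodeConj,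
    natForm_convMul_natForm _ sovEquiv_naturality _ sovEquiv_symm_naturality
      fun X => (sovEquiv F X).apply_symm_apply,
    natForm_convMul_natForm _ sovEquiv_symm_naturality _ sovEquiv_naturality
      fun X => (sovEquiv F X).symm_apply_apply,
    rfl⟩

/-! ### Sovereign functors and involutivity of the antipode -/

theorem antipodeConj_eq_antipode (h : ∀ X (x : F.obj X), sovEquiv F X x = x) :
    antipodeConj F = HopfAlgebra.antipode k := by
  refine hom_ext fun X φ x => ?_
  have h1 : φ ∘ₗ (sovEquiv F X).toLinearMap = φ := by
    ext y
    exact congrArg φ (h X y)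
  have h2 : (sovEquiv F X).symm x = x := by rw [LinearEquiv.symm_apply_eq, h]
  rw [antipodeConj_coeff, h1, h2]

/-- A sovereign structure on the category of finite-dimensional vector spaces is the canonical one,
given by the identification of a space with its bidual. -/
theorem sovEquiv_id_apply [SovereignCategory (FGModuleCat.{u} k)] (V : FGModuleCat.{u} k)
    (x : V) : sovEquiv (𝟭 (FGModuleCat.{u} k)) V x = x := by
  -- Naturality along the linear map k → V with 1 ↦ x: since w fixes the unit vector of k, it fixes
  -- x.
  have h := sovEquiv_naturality (F := 𝟭 (FGModuleCat.{u} k)) (X := 𝟙_ _) (Y := V)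
    (FGModuleCat.ofHom (LinearMap.toSpanSingleton k V x)) (unitEquiv (𝟭 (FGModuleCat.{u} k)) 1)
  rw [sovEquiv_unit] at h
  have h1 : linMap (𝟭 (FGModuleCat.{u} k)) (X := 𝟙_ _) (Y := V)
      (FGModuleCat.ofHom (LinearMap.toSpanSingleton k V x))
      (unitEquiv (𝟭 (FGModuleCat.{u} k)) 1) = x := one_smul k x
  rwa [h1] at h

/-- The comparison maps r_X and l_X preserve the pairings, and sovereignty of F matches F(φ_X) with
ψ at F(X) across them. The identity characterising w_X thus reduces to the one for the identity
functor and ψ, where w is trivial. -/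
theorem sovEquiv_apply_of_isSovereignFunctor [SovereignCategory (FGModuleCat.{u} k)]
    (hF : IsSovereignFunctor F) (X : C) (x : F.obj X) : sovEquiv F X x = x := by
  rw [sovEquiv_eq_iff]
  intro ζ
  obtain ⟨ζ, rfl⟩ :=
    (FGModuleCat.isoToLinearEquiv (mapLeftDualIso F X)).surjective ζ
  have hr : rightForm F X x ((mapLeftDualIso F X).hom.hom.hom ζ) =
      rightForm (𝟭 (FGModuleCat.{u} k)) (F.obj X) x ζ :=
    LinearMap.congr_fun (congrArg (fun t => t.hom.hom) (leftDualIso_evaluation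
      (LeftRigidCategory.leftDual (F.obj X)).exact
      (mapExactPairing F (LeftRigidCategory.leftDual X).exact))) (x ⊗ₜ[k] ζ)
  -- The left dual of F(X) has to be the one chosen by ψ, which need not be the standard dual space;
  -- hence the explicit instance.
  have hl (ξ) := LinearMap.congr_fun (congrArg (fun t => t.hom.hom) (rightDualIso_evaluation
    (@RightRigidCategory.rightDual _ _ _ RigidCategory.toRightRigidCategory (F.obj X)).exact
    (mapExactPairing F (RightRigidCategory.rightDual X).exact))) (ξ ⊗ₜ[k] x)
  have hφ := LinearMap.congr_fun (congrArg (fun t => t.hom.hom) (hF X)) ζ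
  have h := rightForm_sovEquiv (F := 𝟭 (FGModuleCat.{u} k)) (F.obj X) x ζ
  rw [sovEquiv_id_apply] at h
  refine (hr.trans (h.trans (hl _).symm)).trans ?_
  exact congrArg (fun ξ => leftForm F X ξ x) hφ.symm

end Sovereign

end EndDual

end CategoryTheory

end

theorem theorem3p12 {k : Type u} [Field k] {C : Type w} [Category.{v} C] [MonoidalCategory C]
    [SovereignCategory C] (F : C ⥤ FGModuleCat.{u} k) [F.Monoidal] :
    (∃ Φ : EndDual F →ₐ[k] k, IsSovereignCharacter Φ) ∧
    (∀ [SovereignCategory (FGModuleCat.{u} k)], IsSovereignFunctor F →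
      HopfAlgebra.antipode k ∘ₗ HopfAlgebra.antipode k =
        (LinearMap.id : EndDual F →ₗ[k] EndDual F)) := by
  refine ⟨⟨EndDual.sovCharacter F, EndDual.isSovereignCharacter_sovCharacter F⟩, fun hF => ?_⟩
  have h := EndDual.antipodeConj_comp_antipode (F := F)
  rwa [EndDual.antipodeConj_eq_antipode (EndDual.sovEquiv_apply_of_isSovereignFunctor hF)] at h
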